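/- **Model.** A pointer-machine data structure for a finite set $\mathcal P\subset\mathbb R^2$ is a finite directed graph whose vertices are called cells; each cell stores at most one point of $\mathcal P$ and at most two pointers to cells. Its space is the number of its cells. A query whose answer is $X\subseteq\mathcal P$ is answered in time $t$ if there is a set $W$ of at most $t$ cells such that every point of $X$ is stored in some cell of $W$, and $W$ contains a starting cell from which every cell of $W$ can be reached by following pointers inside $W$. (Only the visited cells are charged; computation is free, and the starting cell may depend on the query.) **Problem.** Fix an integer $\Delta\ge 2$. A degree-$\Delta$ polynomial slab is a set $\{(x,y)\in\mathbb R^2: P(x)\le y\le P(x)+w\}$, where $P$ is a real univariate polynomial of degree exactly $\Delta$ and $w>0$. For reals $C,q,s$ and an integer $n$, say that slab reporting on $n$ points is solvable with space $s$ and query time $q+Ck$ if every set $\mathcal P$ of $n$ points in $\mathbb R^2$ has a pointer-machine data structure with at most $s$ cells that answers every query "report $\mathcal P\cap R$", $R$ a degree-$\Delta$ polynomial slab, in time $q+C\,|\mathcal P\cap R|$. **Theorem.** Let $\Delta\ge 2$ be an integer and $C$ a real number. 1. There is a function $\varepsilon(n)\to 0$, depending only on $\Delta$ and $C$, such that for all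 sufficiently large $n$ (the threshold depending only on $\Delta$ and $C$) and all reals $q,s$: if slab reporting on $n$ points is solvable with space $s$ and query time $q+Ck$, then $$ s\;\ge\;\frac{n^{\Delta+1-\varepsilon(n)}}{q^{(\Delta+3)\Delta/2}} . $$ In particular, every solution with query time $Q(n)+O(k)$, where $k$ is the output size, uses space $S(n)\ge n^{-o(1)}\cdot n^{\Delta+1}/Q(n)^{(\Delta+3)\Delta/2}$. 2. Polylogarithmic query time forces $n^{\Delta+1-o(1)}$ space: for all reals $A,b$ there is a function $\varepsilon(n)\to 0$, depending only on $\Delta,C,A,b$, such that for all sufficiently large $n$ (the threshold depending only on $\Delta,C,A,b$) and all reals $q\le A(\log n)^b$ and $s$: if slab reporting on $n$ points is solvable with space $s$ and query time $q+Ck$, then $s\ge n^{\Delta+1-\varepsilon(n)}$. -/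

import Mathlib

open Filter Topology

/-- A data structure in the pointer machine model, for input elements of type `α`: a directed graph
with `size` cells. Each cell stores at most one input element and at most two pointers to cells. -/
structure PointerStructure (α : Type*) where
  size : ℕ
  item : Fin size → Option α
  ptr : Fin size → Fin 2 → Option (Fin size)

namespace PointerStructure

variable {α : Type*} (D : PointerStructure α)

/-- Cell `a` holds a pointer to cell `b`. -/
def PointsTo (a b : Fin D.size) : Prop := ∃ i, D.ptr a i = some b

/-- `W` is a set of cells that a query can visit: it contains a starting cell from which every cell
of `W` is reached by following pointers without leaving `W`. The starting cell is free, and may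
depend on the query in any way. -/
def Explorable (W : Finset (Fin D.size)) : Prop :=
  ∃ r ∈ W, ∀ c ∈ W, Relation.ReflTransGen (fun a b => b ∈ W ∧ D.PointsTo a b) r c

/-- The set `X` of elements can be reported in time `t`: some explorable set of at most `t` cells
stores every element of `X`. Only the visited cells are charged. -/
def CanReport (X : Set α) (t : ℝ) : Prop :=
  ∃ W : Finset (Fin D.size), D.Explorable W ∧
    (∀ x ∈ X, ∃ c ∈ W, D.item c = some x) ∧ (W.card : ℝ) ≤ t

end PointerStructure

/-- The polynomial slab with base polynomial `f` and width `w`. -/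
def polySlab (f : Polynomial ℝ) (w : ℝ) : Set (ℝ × ℝ) :=
  {p | f.eval p.1 ≤ p.2 ∧ p.2 ≤ f.eval p.1 + w}

/-- The structure `D` for the planar point set `P` answers every degree-`Δ` polynomial slab
reporting query in time `q + C * k`, where `k` is the number of reported points. -/
def AnswersSlabs (Δ : ℕ) (q C : ℝ) (P : Finset (ℝ × ℝ)) (D : PointerStructure P) : Prop :=
  ∀ (f : Polynomial ℝ) (w : ℝ), f.natDegree = Δ → 0 < w →
    D.CanReport {p : P | (p : ℝ × ℝ) ∈ polySlab f w}
      (q + C * ({p : P | (p : ℝ × ℝ) ∈ polySlab f w}.ncard : ℝ))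

/-- Degree-`Δ` polynomial slab reporting on `n` points is solvable with space `s` and query time
`q + C * k`: every set of `n` points in the plane has a structure with at most `s` cells that
answers all queries within that time. -/
def SlabReportingSolvable (Δ n : ℕ) (q C s : ℝ) : Prop :=
  ∀ P : Finset (ℝ × ℝ), P.card = n →
    ∃ D : PointerStructure P, (D.size : ℝ) ≤ s ∧ AnswersSlabs Δ q C P D

/-!
The lower bound holds up to a constant factor, on an explicit point set. Let `K` be a large constant
multiple of the query time `q` and `M = n / K`. The input is the grid of integer points `(x, y)`
with `0 ≤ x < K` and `0 ≤ y < M`, together with fewer than `K` further points. The queries are the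
slabs of width one above polynomials whose coefficients are multiples of `Δ + 2`, apart from a tiny
shift of the leading one that keeps the degree equal to `Δ`. The coefficient of `x ^ j` may take
about `M / K ^ j`, that is `n / K ^ (j + 1)`, values before the polynomial leaves the grid, so the
number of queries is of order `n ^ (Δ + 1) / K ^ ((Δ + 1) * (Δ + 2) / 2)`.

Every such slab contains a lattice point in each of the `K` columns, and in total at most `3 * K`
points, so it is answered in time `O(K)`. Two slabs select the same lattice point only where their
polynomials differ by less than one. By Lagrange interpolation the leading coefficient of a
polynomial is bounded by the sum of its absolute values at any `natDegree + 1` natural numbers, so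
two of these polynomials come that close in at most `Δ` columns
(`card_le_of_abs_eval_latticePoly_sub_lt_one`).

Sets of size `K` that pairwise share at most `Δ` elements and are each reported in time `O(K)` cost
space proportional to their total size (`PointerStructure.card_mul_le_mul_size`). Indeed, walking
backwards from a visited cell inside the visited set produces more than `L` cells from which it is
within `L` steps, unless it is close to the starting cell; double counting then shows that at least
a constant fraction of `K` cells have more than `Δ` elements of the reported set within `L` steps.
On the other hand, the bounded neighbourhood of a cell can serve only boundedly many sets in this
way. Multiplying the number of queries by `K` gives `n ^ (Δ + 1) ≤ H * q ^ (Δ * (Δ + 3) / 2) * s` with `H` depending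
on `Δ` and `C` only (`exists_pow_le_mul_of_slabReportingSolvable`). Writing constants and powers of
logarithms as `n ^ ε` with `ε → 0` yields both claims.
-/

/-! ### Space bounds for pointer machines -/

namespace PointerStructure

variable {α : Type*} (D : PointerStructure α)

open Classical in
/-- The cells that can be reached from `u` by following at most `j` pointers. -/
noncomputable def ball : ℕ → Fin D.size → Finset (Fin D.size)
  | 0, u => {u}
  | j + 1, u => insert u ((Finset.univ.filter (D.PointsTo u)).biUnion (ball j))

lemma self_mem_ball (j : ℕ) (u : Fin D.size) : u ∈ D.ball j u := by
  cases j <;> simp [ball]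

lemma card_pointsTo_le (u : Fin D.size) [DecidablePred (D.PointsTo u)] :
    (Finset.univ.filter (D.PointsTo u)).card ≤ 2 := by
  classical
  have h : Finset.univ.filter (D.PointsTo u) ⊆
      (Finset.univ : Finset (Fin 2)).biUnion (fun i => (D.ptr u i).toFinset) := by
    intro v hv
    obtain ⟨i, hi⟩ := (Finset.mem_filter.1 hv).2
    simp only [Finset.mem_biUnion, Finset.mem_univ, true_and]
    exact ⟨i, by simp [hi]⟩
  refine (Finset.card_le_card h).trans (Finset.card_biUnion_le.trans ?_)
  calc ∑ i : Fin 2, (D.ptr u i).toFinset.card ≤ ∑ _i : Fin 2, 1 :=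
        Finset.sum_le_sum fun i _ => by cases D.ptr u i <;> simp
    _ = 2 := by simp

lemma card_ball_lt (j : ℕ) (u : Fin D.size) : (D.ball j u).card < 2 ^ (j + 1) := by
  classical
  induction j generalizing u with
  | zero => simp [ball]
  | succ j ih =>
    have h1 := Finset.card_insert_le u ((Finset.univ.filter (D.PointsTo u)).biUnion (D.ball j))
    have h2 : ((Finset.univ.filter (D.PointsTo u)).biUnion (D.ball j)).card
        ≤ 2 * (2 ^ (j + 1) - 1) :=
      (Finset.card_biUnion_le_card_mul _ _ _ fun v _ => Nat.le_sub_one_of_lt (ih v)).trans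
        (Nat.mul_le_mul_right _ (D.card_pointsTo_le u))
    have h3 : 0 < 2 ^ (j + 1) := by positivity
    have h4 : (D.ball (j + 1) u).card
      ≤ ((Finset.univ.filter (D.PointsTo u)).biUnion (D.ball j)).card + 1 := by
      convert h1 using 1
      simp only [ball]
    rw [pow_succ 2 (j + 1)]
    omega

lemma ball_mono_succ (j : ℕ) (u : Fin D.size) : D.ball j u ⊆ D.ball (j + 1) u := by
  classical
  induction j generalizing u with
  | zero => simp [ball]
  | succ j ih =>
    intro v hv
    rw [ball] at hv ⊢
    simp only [Finset.mem_insert, Finset.mem_biUnion, Finset.mem_filter] at hv ⊢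
    rcases hv with hv | ⟨y, hy, hv⟩
    · exact Or.inl hv
    · exact Or.inr ⟨y, hy, ih y hv⟩

lemma mem_ball_succ_of_pointsTo {j : ℕ} {u y v : Fin D.size} (h : D.PointsTo u y)
    (hv : v ∈ D.ball j y) : v ∈ D.ball (j + 1) u := by
  classical
  rw [ball]
  simp only [Finset.mem_insert, Finset.mem_biUnion, Finset.mem_filter]
  exact Or.inr ⟨y, ⟨Finset.mem_univ _, h⟩, hv⟩

/-- If `v` is not within `j` steps of the starting cell, then the sets of cells of `W` that reach
`v` within `0, 1, …, j` steps grow strictly: one that stops growing is closed under predecessors in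
`W`, so it contains the starting cell. -/
lemma mem_ball_or_lt_card [DecidableEq (Fin D.size)] {W : Finset (Fin D.size)} {r v : Fin D.size}
    (hv : v ∈ W) (hr : r ∈ W)
    (h : Relation.ReflTransGen (fun a b => b ∈ W ∧ D.PointsTo a b) r v) (j : ℕ) :
    v ∈ D.ball j r ∨ j < (W.filter fun u => v ∈ D.ball j u).card := by
  induction j with
  | zero =>
    exact Or.inr (Finset.card_pos.2 ⟨v, Finset.mem_filter.2 ⟨hv, D.self_mem_ball 0 v⟩⟩)
  | succ j ih =>
    rcases ih with ih | ih
    · exact Or.inl (D.ball_mono_succ j r ih)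
    have hsub : (W.filter fun u => v ∈ D.ball j u) ⊆ W.filter fun u => v ∈ D.ball (j + 1) u :=
      Finset.monotone_filter_right _ fun u _ hu => D.ball_mono_succ j u hu
    rcases hsub.eq_or_ssubset with heq | hlt
    · left
      have key : ∀ a, Relation.ReflTransGen (fun a b => b ∈ W ∧ D.PointsTo a b) a v → a ∈ W →
          v ∈ D.ball j a := by
        intro a ha
        induction ha using Relation.ReflTransGen.head_induction_on with
        | refl => exact fun _ => D.self_mem_ball j v
        | head hab _ ihb =>
          intro haW
          have h1 := D.mem_ball_succ_of_pointsTo hab.2 (ihb hab.1)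
          have h2 := (Finset.mem_filter (p := fun u => v ∈ D.ball (j + 1) u)).2 ⟨haW, h1⟩
          rw [← heq] at h2
          exact (Finset.mem_filter.1 h2).2
      exact D.ball_mono_succ j r (key r h hr)
    · exact Or.inr (lt_of_le_of_lt ih (Finset.card_lt_card hlt))

open Classical in
/-- The elements stored in the cells within `j` steps of `u`. -/
noncomputable def nearItems (j : ℕ) (u : Fin D.size) : Finset α :=
  (D.ball j u).biUnion fun c => (D.item c).toFinset

lemma mem_nearItems {j : ℕ} {u c : Fin D.size} {x : α} (hc : c ∈ D.ball j u)
    (hx : D.item c = some x) : x ∈ D.nearItems j u := by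
  classical
  exact Finset.mem_biUnion.2 ⟨c, hc, by simp [hx]⟩

lemma card_nearItems_le (j : ℕ) (u : Fin D.size) : (D.nearItems j u).card ≤ 2 ^ (j + 1) := by
  classical
  have h := Finset.card_biUnion_le_card_mul (D.ball j u) (fun c => (D.item c).toFinset) 1
    fun c _ => by cases D.item c <;> simp
  have := D.card_ball_lt j u
  unfold nearItems
  omega

/-- A set reported in time proportional to its size is dense near many cells: at least a constant
fraction of `|G|` cells have more than `β` elements of `G` within `L` steps. Counted are the pairs
of a visited cell and an element of `G` stored within `L` steps of it: all but few elements lie in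
more than `L` such pairs, while a cell that is not dense lies in at most `β` of them. -/
lemma card_le_mul_card_dense [DecidableEq α] {G : Finset α} {X : Set α} {a β L : ℕ} {t : ℝ}
    (hGX : (G : Set α) ⊆ X) (hX : D.CanReport X t) (ht : t ≤ a * G.card)
    (hL : 2 * (β * a + 1) ≤ L) (hG : 2 ^ (L + 2) ≤ G.card) :
    G.card ≤ 2 ^ (L + 1) *
      (Finset.univ.filter fun u => β < (D.nearItems L u ∩ G).card).card := by
  classical
  obtain ⟨W, ⟨r, hr, hreach⟩, hstore, hcard⟩ := hX
  have hW : W.card ≤ a * G.card := by exact_mod_cast hcard.trans ht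
  set S := Finset.univ.filter fun u => β < (D.nearItems L u ∩ G).card
  have hswap : ∑ u ∈ W, (D.nearItems L u ∩ G).card
      = ∑ x ∈ G, (W.filter fun u => x ∈ D.nearItems L u).card := by
    have := Finset.sum_card_bipartiteAbove_eq_sum_card_bipartiteBelow (s := W) (t := G)
      (fun u x => x ∈ D.nearItems L u)
    simp only [Finset.bipartiteAbove, Finset.bipartiteBelow] at this
    rw [← this]
    refine Finset.sum_congr rfl fun u _ => ?_
    rw [Finset.inter_comm, Finset.filter_mem_eq_inter]
  -- A cell that is not dense contributes at most `β`, and a dense one at most the size of its ball.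
  have hupper : ∑ u ∈ W, (D.nearItems L u ∩ G).card ≤ W.card * β + 2 ^ (L + 1) * S.card := by
    calc ∑ u ∈ W, (D.nearItems L u ∩ G).card
        ≤ ∑ u ∈ W, (β + if u ∈ S then 2 ^ (L + 1) else 0) := by
          refine Finset.sum_le_sum fun u _ => ?_
          split_ifs with hu
          · exact ((Finset.card_le_card Finset.inter_subset_left).trans
              (D.card_nearItems_le L u)).trans (Nat.le_add_left _ _)
          · simpa [S] using hu
      _ = W.card * β + (W ∩ S).card * 2 ^ (L + 1) := by
          rw [Finset.sum_add_distrib, ← Finset.sum_filter, Finset.filter_mem_eq_inter]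
          simp
      _ ≤ _ := by
          rw [mul_comm (2 ^ (L + 1))]
          gcongr
          exact Finset.inter_subset_right
  -- Each element not stored near the starting cell is within `L` steps of more than `L` visited
  -- cells.
  have hlower : (G.card - 2 ^ (L + 1)) * L
      ≤ ∑ x ∈ G, (W.filter fun u => x ∈ D.nearItems L u).card := by
    have h1 : G.card - 2 ^ (L + 1) ≤ (G \ D.nearItems L r).card :=
      (Nat.sub_le_sub_left (D.card_nearItems_le L r) _).trans (Finset.le_card_sdiff _ _)
    calc (G.card - 2 ^ (L + 1)) * L ≤ (G \ D.nearItems L r).card * L := by gcongr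
      _ ≤ ∑ x ∈ G \ D.nearItems L r, (W.filter fun u => x ∈ D.nearItems L u).card := by
          rw [← smul_eq_mul]
          refine Finset.card_nsmul_le_sum _ _ _ fun x hx => ?_
          obtain ⟨hxG, hxr⟩ := Finset.mem_sdiff.1 hx
          obtain ⟨c, hc, hcx⟩ := hstore x (hGX hxG)
          rcases D.mem_ball_or_lt_card hc hr (hreach c hc) L with h | h
          · exact absurd (D.mem_nearItems h hcx) hxr
          · exact h.le.trans (Finset.card_le_card
              (Finset.monotone_filter_right _ fun u _ hu => D.mem_nearItems hu hcx))
      _ ≤ _ := Finset.sum_le_sum_of_subset Finset.sdiff_subset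
  rw [← hswap] at hlower
  -- The choice of `L` makes the lower count exceed what the cells that are not dense can absorb.
  have h2 : G.card ≤ 2 * (G.card - 2 ^ (L + 1)) := by
    rw [pow_succ 2 (L + 1)] at hG
    omega
  have h3 : G.card * (β * a + 1) ≤ (G.card - 2 ^ (L + 1)) * L :=
    calc G.card * (β * a + 1) ≤ 2 * (G.card - 2 ^ (L + 1)) * (β * a + 1) := by gcongr
      _ = (G.card - 2 ^ (L + 1)) * (2 * (β * a + 1)) := by ring
      _ ≤ _ := by gcongr
  have h4 : W.card * β ≤ a * G.card * β := by gcongr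
  nlinarith

/-- The space bound for pointer machines: if the sets `G i` have `K` elements each and pairwise
share at most `β`, and each is contained in a set that is reported in time `a * K`, then the number
of cells is at least a constant times the total size of the `G i`. Around each cell, a family member
with more than `β` elements nearby is determined by the nearby elements it contains, so only
boundedly many members are dense near any one cell. -/
theorem card_mul_le_mul_size {ι : Type*} [DecidableEq α] (I : Finset ι) (G : ι → Finset α)
    (X : ι → Set α) {a β L K : ℕ} (t : ι → ℝ)
    (hGX : ∀ i ∈ I, (G i : Set α) ⊆ X i) (hX : ∀ i ∈ I, D.CanReport (X i) (t i))
    (ht : ∀ i ∈ I, t i ≤ a * K) (hcard : ∀ i ∈ I, (G i).card = K)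
    (hinter : ∀ i ∈ I, ∀ j ∈ I, i ≠ j → (G i ∩ G j).card ≤ β)
    (hL : 2 * (β * a + 1) ≤ L) (hK : 2 ^ (L + 2) ≤ K) :
    I.card * K ≤ 2 ^ (L + 1) * 2 ^ 2 ^ (L + 1) * D.size := by
  classical
  have hswap := Finset.sum_card_bipartiteAbove_eq_sum_card_bipartiteBelow (s := I)
    (t := (Finset.univ : Finset (Fin D.size))) (fun i u => β < (D.nearItems L u ∩ G i).card)
  simp only [Finset.bipartiteAbove, Finset.bipartiteBelow] at hswap
  have hcell : ∀ u, (I.filter fun i => β < (D.nearItems L u ∩ G i).card).card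
      ≤ 2 ^ 2 ^ (L + 1) := by
    intro u
    calc _ ≤ (D.nearItems L u).powerset.card := by
          refine Finset.card_le_card_of_injOn (fun i => D.nearItems L u ∩ G i)
            (fun i _ => by simp) ?_
          intro i hi j hj hij
          by_contra hne
          simp only [Finset.coe_filter, Set.mem_ofPred_eq] at hi hj hij
          have h1 : D.nearItems L u ∩ G i ⊆ G i ∩ G j :=
            Finset.subset_inter Finset.inter_subset_right (hij ▸ Finset.inter_subset_right)
          exact absurd (Finset.card_le_card h1)
            (not_le.2 ((hinter i hi.1 j hj.1 hne).trans_lt hi.2))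
      _ ≤ _ := by
          rw [Finset.card_powerset]
          exact Nat.pow_le_pow_right (by norm_num) (D.card_nearItems_le L u)
  calc I.card * K = ∑ i ∈ I, (G i).card := by
        rw [Finset.sum_congr rfl hcard, Finset.sum_const, smul_eq_mul]
    _ ≤ ∑ i ∈ I, 2 ^ (L + 1) *
          (Finset.univ.filter fun u => β < (D.nearItems L u ∩ G i).card).card :=
        Finset.sum_le_sum fun i hi => D.card_le_mul_card_dense (hGX i hi) (hX i hi)
          (by rw [hcard i hi]; exact ht i hi) hL (by rw [hcard i hi]; exact hK)
    _ = 2 ^ (L + 1) * ∑ u, (I.filter fun i => β < (D.nearItems L u ∩ G i).card).card := by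
        rw [← Finset.mul_sum, hswap]
    _ ≤ 2 ^ (L + 1) * ∑ _u : Fin D.size, 2 ^ 2 ^ (L + 1) := by
        gcongr with u; exact hcell u
    _ = _ := by simp; ring

end PointerStructure

/-! ### Lattice polynomials -/

open Polynomial in
/-- A polynomial whose leading coefficient is large is small at few natural numbers: Lagrange
interpolation writes the leading coefficient as a combination of values at
`natDegree + 1` natural numbers, with weights of absolute value at most one. -/
lemma card_le_natDegree_of_abs_eval_lt_one {p : ℝ[X]} {s : Finset ℕ}
    (hlead : (p.natDegree : ℝ) + 1 ≤ |p.leadingCoeff|)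
    (hs : ∀ x ∈ s, |p.eval (x : ℝ)| < 1) : s.card ≤ p.natDegree := by
  by_contra! hlt
  obtain ⟨t, hts, htc⟩ := Finset.exists_subset_card_eq (Nat.succ_le_of_lt hlt)
  have hp : p ≠ 0 := by
    rintro rfl
    norm_num at hlead
  have hsum := Lagrange.leadingCoeff_eq_sum (s := t) (v := fun x : ℕ => (x : ℝ)) (P := p)
    (Nat.cast_injective.injOn) (by rw [htc, degree_eq_natDegree hp]; rfl)
  have hden : ∀ x ∈ t, 1 ≤ |∏ y ∈ t.erase x, ((x : ℝ) - y)| := by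
    intro x _
    rw [Finset.abs_prod]
    refine Finset.one_le_prod fun y hy => ?_
    have h1 : (x : ℤ) - y ≠ 0 := by
      have := (Finset.mem_erase.1 hy).1
      omega
    exact_mod_cast Int.one_le_abs h1
  have hne : t.Nonempty := Finset.card_pos.1 (by omega)
  have : |p.leadingCoeff| < t.card := by
    rw [hsum]
    calc _ ≤ ∑ x ∈ t, |p.eval (x : ℝ) / ∏ y ∈ t.erase x, ((x : ℝ) - y)| :=
          Finset.abs_sum_le_sum_abs _ _
      _ < ∑ _x ∈ t, (1 : ℝ) := by
          refine Finset.sum_lt_sum_of_nonempty hne fun x hx => ?_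
          rw [abs_div, div_lt_one (by linarith [hden x hx])]
          exact (hs x (hts hx)).trans_le (hden x hx)
      _ = t.card := by simp
  rw [htc] at this
  push_cast at this
  linarith

open Polynomial in
/-- The polynomial of degree `Δ` whose coefficients are the `Δ + 2`-fold multiples of the naturals
`c j`, except that the leading one is shifted by `K ^ (-Δ)`, which keeps the degree equal to `Δ`
even when all the `c j` vanish. -/
noncomputable def latticePoly (Δ K : ℕ) (c : ℕ → ℕ) : ℝ[X] :=
  C ((K : ℝ) ^ Δ)⁻¹ * X ^ Δ + ∑ j ∈ Finset.range (Δ + 1), C (((Δ + 2) * c j : ℕ) : ℝ) * X ^ j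

section latticePoly
open Polynomial

lemma coeff_sum_range_C_mul_X_pow (m : ℕ) (a : ℕ → ℝ) (i : ℕ) :
    (∑ j ∈ Finset.range m, C (a j) * X ^ j : ℝ[X]).coeff i = if i < m then a i else 0 := by
  simp [Polynomial.finsetSum_coeff, coeff_C_mul, coeff_X_pow]

lemma natDegree_latticePoly {Δ K : ℕ} (hK : 0 < K) (c : ℕ → ℕ) :
    (latticePoly Δ K c).natDegree = Δ := by
  refine natDegree_eq_of_le_of_coeff_ne_zero ?_ ?_
  · refine natDegree_add_le_of_degree_le (natDegree_C_mul_X_pow_le _ _) ?_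
    exact natDegree_sum_le_of_forall_le _ _ fun j hj =>
      (natDegree_C_mul_X_pow_le _ _).trans (Nat.lt_succ_iff.1 (Finset.mem_range.1 hj))
  · rw [latticePoly, coeff_add, coeff_sum_range_C_mul_X_pow]
    simp only [coeff_C_mul, coeff_X_pow, if_true, mul_one, Nat.lt_succ_self]
    positivity

lemma eval_latticePoly (Δ K : ℕ) (c : ℕ → ℕ) (x : ℝ) :
    (latticePoly Δ K c).eval x = ((K : ℝ) ^ Δ)⁻¹ * x ^ Δ +
      ∑ j ∈ Finset.range (Δ + 1), (((Δ + 2) * c j : ℕ) : ℝ) * x ^ j := by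
  simp [latticePoly, eval_finsetSum]

/-- Two distinct such polynomials differ by less than one at no more than `Δ` natural numbers,
because the leading coefficient of their difference is a nonzero multiple of `Δ + 2`. -/
lemma card_le_of_abs_eval_latticePoly_sub_lt_one {Δ K : ℕ} {c d : ℕ → ℕ} {s : Finset ℕ}
    (hcd : ∃ j ∈ Finset.range (Δ + 1), c j ≠ d j)
    (hs : ∀ x ∈ s, |(latticePoly Δ K c).eval (x : ℝ) - (latticePoly Δ K d).eval (x : ℝ)| < 1) :
    s.card ≤ Δ := by
  set p : ℝ[X] := ∑ j ∈ Finset.range (Δ + 1),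
    C ((((Δ + 2) * ((c j : ℤ) - d j) : ℤ)) : ℝ) * X ^ j with hp
  have hcoeff : ∀ i, p.coeff i =
      if i < Δ + 1 then ((((Δ + 2) * ((c i : ℤ) - d i) : ℤ)) : ℝ) else 0 :=
    fun i => coeff_sum_range_C_mul_X_pow _ _ i
  have hdeg : p.natDegree ≤ Δ :=
    natDegree_sum_le_of_forall_le _ _ fun j hj =>
      (natDegree_C_mul_X_pow_le _ _).trans (Nat.lt_succ_iff.1 (Finset.mem_range.1 hj))
  have hp0 : p ≠ 0 := by
    obtain ⟨j, hj, hne⟩ := hcd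
    intro h0
    have h1 := hcoeff j
    rw [h0, coeff_zero, if_pos (Finset.mem_range.1 hj)] at h1
    have h2 : ((Δ : ℤ) + 2) * ((c j : ℤ) - d j) = 0 := by exact_mod_cast h1.symm
    rcases mul_eq_zero.1 h2 with h | h <;> omega
  have hlead : (p.natDegree : ℝ) + 1 ≤ |p.leadingCoeff| := by
    have h1 : p.leadingCoeff ≠ 0 := leadingCoeff_ne_zero.2 hp0
    rw [leadingCoeff, hcoeff, if_pos (Nat.lt_succ_of_le hdeg)] at h1 ⊢
    have h2 : (c p.natDegree : ℤ) - d p.natDegree ≠ 0 := by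
      intro h
      simp [h] at h1
    have h3 := Int.one_le_abs h2
    have h4 : (p.natDegree : ℤ) + 1 ≤ |((Δ : ℤ) + 2) * ((c p.natDegree : ℤ) - d p.natDegree)| := by
      rw [abs_mul, abs_of_nonneg (by positivity : (0 : ℤ) ≤ (Δ : ℤ) + 2)]
      have : (p.natDegree : ℤ) ≤ Δ := by exact_mod_cast hdeg
      nlinarith
    exact_mod_cast h4
  refine (card_le_natDegree_of_abs_eval_lt_one hlead fun x hx => ?_).trans hdeg
  convert hs x hx using 2
  rw [eval_latticePoly, eval_latticePoly, add_sub_add_left_eq_sub, ← Finset.sum_sub_distrib, hp,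
    eval_finsetSum]
  refine Finset.sum_congr rfl fun j _ => ?_
  simp only [eval_mul, eval_C, eval_pow, eval_X]
  push_cast
  ring

lemma eval_latticePoly_nonneg (Δ K : ℕ) (c : ℕ → ℕ) (x : ℕ) :
    0 ≤ (latticePoly Δ K c).eval (x : ℝ) := by
  rw [eval_latticePoly]
  positivity

/-- The number of admissible values `0, 1, …` of `c j`: with these the polynomials
`latticePoly Δ K c` stay below `M` on `{0, …, K - 1}`, if `2 ≤ M`. It is never zero, so that the
bound on the number of polynomials survives when `K ^ j` exceeds `M`. -/
def coeffCount (Δ K M j : ℕ) : ℕ := (M - 2) / ((Δ + 1) * (Δ + 2) * K ^ j) + 1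

lemma eval_latticePoly_le {Δ K M : ℕ} (hM : 2 ≤ M) {c : ℕ → ℕ}
    (hc : ∀ j ∈ Finset.range (Δ + 1), c j < coeffCount Δ K M j) {x : ℕ} (hx : x < K) :
    (latticePoly Δ K c).eval (x : ℝ) ≤ (M - 1 : ℕ) := by
  have hK : 0 < K := by omega
  have h1 : ((K : ℝ) ^ Δ)⁻¹ * (x : ℝ) ^ Δ ≤ 1 := by
    rw [inv_mul_le_iff₀ (by positivity), mul_one]
    gcongr
  have h2 : ∀ j ∈ Finset.range (Δ + 1),
      (((Δ + 2) * c j : ℕ) : ℝ) * (x : ℝ) ^ j ≤ ((M - 2 : ℕ) : ℝ) / (Δ + 1) := by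
    intro j hj
    have h3 : c j * ((Δ + 1) * (Δ + 2) * K ^ j) ≤ M - 2 :=
      (Nat.le_div_iff_mul_le (by positivity)).1 (Nat.lt_succ_iff.1 (hc j hj))
    rw [le_div_iff₀ (by positivity)]
    have h4 : (Δ + 2) * c j * x ^ j * (Δ + 1) ≤ M - 2 :=
      calc (Δ + 2) * c j * x ^ j * (Δ + 1) ≤ (Δ + 2) * c j * K ^ j * (Δ + 1) := by gcongr
        _ = c j * ((Δ + 1) * (Δ + 2) * K ^ j) := by ring
        _ ≤ _ := h3
    exact_mod_cast h4
  have h5 := Finset.sum_le_sum h2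
  rw [Finset.sum_const, Finset.card_range, nsmul_eq_mul] at h5
  have h6 : ((Δ + 1 : ℕ) : ℝ) * (((M - 2 : ℕ) : ℝ) / (Δ + 1)) = ((M - 2 : ℕ) : ℝ) := by
    push_cast
    field_simp
  have h7 : ((M - 1 : ℕ) : ℝ) = ((M - 2 : ℕ) : ℝ) + 1 := by
    exact_mod_cast (by omega : M - 1 = M - 2 + 1)
  rw [eval_latticePoly, h7]
  linarith

end latticePoly

/-! ### Lattice points in slabs -/

/-- The lattice point on or next above the graph of `f` at `x`, for `f` nonnegative at `x`: the
ceiling is a natural number, so it is `0` where `f` is negative. -/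
noncomputable def latticeAbove (f : Polynomial ℝ) (x : ℕ) : ℝ × ℝ := (x, (⌈f.eval (x : ℝ)⌉₊ : ℝ))

lemma latticeAbove_injective (f : Polynomial ℝ) : Function.Injective (latticeAbove f) := by
  intro x y h
  exact Nat.cast_injective (congrArg Prod.fst h)

/-- The points `(x, y)` with integer coordinates `0 ≤ x < K` and `0 ≤ y < M`. -/
noncomputable def latticeGrid (K M : ℕ) : Finset (ℝ × ℝ) :=
  (Finset.range K ×ˢ Finset.range M).map
    ⟨fun z => ((z.1 : ℝ), (z.2 : ℝ)), fun z z' h => by simpa [Prod.ext_iff] using h⟩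

lemma card_latticeGrid (K M : ℕ) : (latticeGrid K M).card = K * M := by
  simp [latticeGrid]

lemma mem_latticeGrid {K M : ℕ} {p : ℝ × ℝ} :
    p ∈ latticeGrid K M ↔ ∃ x < K, ∃ y < M, p = ((x : ℝ), (y : ℝ)) := by
  simp only [latticeGrid, Finset.mem_map, Finset.mem_product, Finset.mem_range,
    Prod.exists]
  constructor
  · rintro ⟨x, y, ⟨hx, hy⟩, rfl⟩
    exact ⟨x, hx, y, hy, rfl⟩
  · rintro ⟨x, hx, y, hy, rfl⟩
    exact ⟨x, y, ⟨hx, hy⟩, rfl⟩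

lemma latticeAbove_mem_polySlab {f : Polynomial ℝ} {x : ℕ} (hf : 0 ≤ f.eval (x : ℝ)) :
    latticeAbove f x ∈ polySlab f 1 :=
  ⟨Nat.le_ceil _, (Nat.ceil_lt_add_one hf).le⟩

/-- In each column of the grid a slab of width one has at most two points. -/
lemma card_filter_polySlab_le [DecidableEq (ℝ × ℝ)] {K M : ℕ} {f : Polynomial ℝ}
    {P : Finset (ℝ × ℝ)} [DecidablePred (· ∈ polySlab f 1)] (hP : latticeGrid K M ⊆ P) :
    (P.filter (· ∈ polySlab f 1)).card ≤ 2 * K + (P.card - K * M) := by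
  have hsub : P.filter (· ∈ polySlab f 1) ⊆
      (Finset.range K ×ˢ Finset.range 2).image
        (fun z => ((z.1 : ℝ), ((⌈f.eval (z.1 : ℝ)⌉₊ + z.2 : ℕ) : ℝ))) ∪
      (P \ latticeGrid K M) := by
    intro p hp
    obtain ⟨hpP, hlow, hup⟩ := Finset.mem_filter.1 hp
    by_cases hg : p ∈ latticeGrid K M
    · refine Finset.mem_union_left _ ?_
      obtain ⟨x, hx, y, hy, rfl⟩ := mem_latticeGrid.1 hg
      simp only at hlow hup
      have h1 : ⌈f.eval (x : ℝ)⌉₊ ≤ y := Nat.ceil_le.2 hlow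
      have h2 : y ≤ ⌈f.eval (x : ℝ)⌉₊ + 1 := by
        have := Nat.le_ceil (f.eval (x : ℝ))
        exact_mod_cast hup.trans (add_le_add_left this 1)
      refine Finset.mem_image.2 ⟨(x, y - ⌈f.eval (x : ℝ)⌉₊), ?_, ?_⟩
      · simp only [Finset.mem_product, Finset.mem_range]
        omega
      · simp only [Prod.mk.injEq, true_and]
        rw [Nat.add_sub_cancel' h1]
    · exact Finset.mem_union_right _ (Finset.mem_sdiff.2 ⟨hpP, hg⟩)
  refine (Finset.card_le_card hsub).trans ((Finset.card_union_le _ _).trans ?_)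
  rw [Finset.card_sdiff_of_subset hP, card_latticeGrid]
  gcongr
  refine Finset.card_image_le.trans ?_
  simp [mul_comm]

/-! ### The space bound up to a constant factor -/

open Polynomial in
/-- Every query time is at least one and every structure has a cell, since a slab that misses all
points still has to be answered. -/
lemma SlabReportingSolvable.one_le {Δ n : ℕ} {q A s : ℝ}
    (h : SlabReportingSolvable Δ n q A s) : 1 ≤ q ∧ 1 ≤ s := by
  classical
  obtain ⟨P, -, hP⟩ := Infinite.exists_superset_card_eq (∅ : Finset (ℝ × ℝ)) n (by simp)
  obtain ⟨D, hD, hans⟩ := h P hP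
  obtain ⟨b, hb⟩ := (P.image fun p => p.2 - p.1 ^ Δ).exists_le
  have hempty : {p : P | (p : ℝ × ℝ) ∈ polySlab (X ^ Δ + C (b + 1)) 1} = ∅ := by
    refine Set.eq_empty_of_forall_notMem fun p hp => ?_
    have h1 := hb _ (Finset.mem_image_of_mem _ p.2)
    have h2 : (X ^ Δ + C (b + 1)).eval (p : ℝ × ℝ).1 ≤ (p : ℝ × ℝ).2 := hp.1
    simp only [eval_add, eval_pow, eval_X, eval_C] at h2
    linarith
  obtain ⟨W, ⟨r, hr, -⟩, -, hcard⟩ :=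
    hans (X ^ Δ + C (b + 1)) 1 (natDegree_X_pow_add_C) one_pos
  rw [hempty, Set.ncard_empty, Nat.cast_zero, mul_zero, add_zero] at hcard
  have h1 : (1 : ℝ) ≤ W.card := by exact_mod_cast Finset.card_pos.2 ⟨r, hr⟩
  have h2 : (1 : ℝ) ≤ D.size := by exact_mod_cast r.pos
  exact ⟨h1.trans hcard, h2.trans hD⟩

/-- The counting bound on the lattice: the slabs of width one above the lattice polynomials each
contain `K` lattice points, pairwise share at most `Δ` of these, and contain at most `3 * K` of the
given points. -/
lemma prod_coeffCount_mul_le {Δ n K M L c : ℕ} {q C s : ℝ} (hM : 2 ≤ M) (hKM : K * M ≤ n)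
    (hn : n ≤ K * (M + 1)) (hq : q ≤ K) (hC : C ≤ c) (hL : 2 * (Δ * (1 + 3 * c) + 1) ≤ L)
    (hK : 2 ^ (L + 2) ≤ K) (h : SlabReportingSolvable Δ n q C s) :
    (((∏ j ∈ Finset.range (Δ + 1), coeffCount Δ K M j) * K : ℕ) : ℝ)
      ≤ ((2 ^ (L + 1) * 2 ^ 2 ^ (L + 1) : ℕ) : ℝ) * s := by
  classical
  have hK0 : 0 < K := lt_of_lt_of_le (by positivity) hK
  obtain ⟨P, hgrid, hP⟩ := Infinite.exists_superset_card_eq (latticeGrid K M) n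
    (by rwa [card_latticeGrid])
  obtain ⟨D, hD, hans⟩ := h P hP
  let ext : (Fin (Δ + 1) → ℕ) → ℕ → ℕ := fun t j => if hj : j < Δ + 1 then t ⟨j, hj⟩ else 0
  let F : (Fin (Δ + 1) → ℕ) → Polynomial ℝ := fun t => latticePoly Δ K (ext t)
  let I : Finset (Fin (Δ + 1) → ℕ) :=
    Fintype.piFinset fun j => Finset.range (coeffCount Δ K M j)
  let G : (Fin (Δ + 1) → ℕ) → Finset P := fun t =>
    ((Finset.range K).image (latticeAbove (F t))).subtype (· ∈ P)
  have hI : I.card = ∏ j ∈ Finset.range (Δ + 1), coeffCount Δ K M j := by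
    simp [I, Finset.prod_range]
  have hmemG : ∀ t (p : P), p ∈ G t ↔ ∃ x < K, latticeAbove (F t) x = p := by
    intro t p
    simp [G]
  have habove : ∀ t ∈ I, ∀ x < K, latticeAbove (F t) x ∈ P := by
    intro t ht x hx
    refine hgrid (mem_latticeGrid.2 ⟨x, hx, _, ?_, rfl⟩)
    have h1 : (F t).eval (x : ℝ) ≤ (M - 1 : ℕ) := by
      refine eval_latticePoly_le hM (fun j hj => ?_) hx
      have h2 := Finset.mem_range.1 hj
      simp only [ext, h2, dif_pos]
      exact Finset.mem_range.1 (Fintype.mem_piFinset.1 ht ⟨j, h2⟩)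
    have h3 := Nat.ceil_le.2 h1
    omega
  have hcardG : ∀ t ∈ I, (G t).card = K := by
    intro t ht
    rw [Finset.card_subtype, Finset.filter_true_of_mem,
      Finset.card_image_of_injective _ (latticeAbove_injective _), Finset.card_range]
    intro p hp
    obtain ⟨x, hx, rfl⟩ := Finset.mem_image.1 hp
    exact habove t ht x (Finset.mem_range.1 hx)
  have hinter : ∀ t ∈ I, ∀ u ∈ I, t ≠ u → (G t ∩ G u).card ≤ Δ := by
    intro t _ u _ htu
    set S := (Finset.range K).filter fun x : ℕ =>
      |(F t).eval (x : ℝ) - (F u).eval (x : ℝ)| < 1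
    have hS : S.card ≤ Δ := by
      refine card_le_of_abs_eval_latticePoly_sub_lt_one ?_ fun x hx => (Finset.mem_filter.1 hx).2
      obtain ⟨j, hj⟩ := Function.ne_iff.1 htu
      exact ⟨j, Finset.mem_range.2 j.2, by simpa only [ext, j.2, dif_pos] using hj⟩
    refine le_trans ?_ hS
    have hsub : (G t ∩ G u).map (Function.Embedding.subtype (· ∈ P)) ⊆
        S.image (latticeAbove (F t)) := by
      intro z hz
      obtain ⟨p, hp, rfl⟩ := Finset.mem_map.1 hz
      obtain ⟨hpt, hpu⟩ := Finset.mem_inter.1 hp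
      obtain ⟨x, hx, hxp⟩ := (hmemG t p).1 hpt
      obtain ⟨y, -, hyp⟩ := (hmemG u p).1 hpu
      refine Finset.mem_image.2 ⟨x, Finset.mem_filter.2 ⟨Finset.mem_range.2 hx, ?_⟩, hxp⟩
      have h1 := hxp.trans hyp.symm
      have h2 : x = y := Nat.cast_injective (congrArg Prod.fst h1)
      subst h2
      have h3 : ⌈(F t).eval (x : ℝ)⌉₊ = ⌈(F u).eval (x : ℝ)⌉₊ :=
        Nat.cast_injective (congrArg Prod.snd h1)
      have h4 := Nat.le_ceil ((F t).eval (x : ℝ))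
      have h5 := Nat.le_ceil ((F u).eval (x : ℝ))
      have h6 := Nat.ceil_lt_add_one (eval_latticePoly_nonneg Δ K (ext t) x)
      have h7 := Nat.ceil_lt_add_one (eval_latticePoly_nonneg Δ K (ext u) x)
      change (⌈(F t).eval (x : ℝ)⌉₊ : ℝ) < (F t).eval (x : ℝ) + 1 at h6
      change (⌈(F u).eval (x : ℝ)⌉₊ : ℝ) < (F u).eval (x : ℝ) + 1 at h7
      rw [h3] at h4 h6
      rw [abs_lt]
      constructor <;> linarith
    calc (G t ∩ G u).card = _ := (Finset.card_map _).symm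
      _ ≤ _ := Finset.card_le_card hsub
      _ ≤ S.card := Finset.card_image_le
  -- The given points outside the grid number at most `K`.
  have houtput : ∀ t, {p : P | (p : ℝ × ℝ) ∈ polySlab (F t) 1}.ncard ≤ 3 * K := by
    intro t
    have h1 : Subtype.val '' {p : P | (p : ℝ × ℝ) ∈ polySlab (F t) 1} =
        (P.filter (· ∈ polySlab (F t) 1) : Set (ℝ × ℝ)) := by
      ext z
      simp [and_comm]
    rw [← Set.ncard_image_of_injective _ Subtype.val_injective, h1, Set.ncard_coe_finset]
    have h2 := card_filter_polySlab_le (f := F t) hgrid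
    have h3 : K * (M + 1) = K * M + K := by ring
    omega
  have key := D.card_mul_le_mul_size I G
    (fun t => {p : P | (p : ℝ × ℝ) ∈ polySlab (F t) 1}) (a := 1 + 3 * c) (β := Δ) (L := L) (K := K)
    (fun t => q + C * ({p : P | (p : ℝ × ℝ) ∈ polySlab (F t) 1}.ncard : ℝ)) ?_ ?_ ?_
    hcardG hinter hL hK
  · rw [hI] at key
    calc _ ≤ ((2 ^ (L + 1) * 2 ^ 2 ^ (L + 1) * D.size : ℕ) : ℝ) := by exact_mod_cast key
      _ ≤ _ := by
        rw [Nat.cast_mul]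
        gcongr
  · intro t _ p hp
    obtain ⟨x, -, hxp⟩ := (hmemG t p).1 hp
    change (p : ℝ × ℝ) ∈ polySlab (F t) 1
    rw [← hxp]
    exact latticeAbove_mem_polySlab (eval_latticePoly_nonneg Δ K (ext t) x)
  · exact fun t _ => hans (F t) 1 (natDegree_latticePoly hK0 _) one_pos
  · intro t _
    have h1 : ({p : P | (p : ℝ × ℝ) ∈ polySlab (F t) 1}.ncard : ℝ) ≤ 3 * K := by
      exact_mod_cast houtput t
    have h2 : C * ({p : P | (p : ℝ × ℝ) ∈ polySlab (F t) 1}.ncard : ℝ) ≤ c * (3 * K) :=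
      mul_le_mul hC h1 (by positivity) (by positivity)
    push_cast
    linarith

lemma prod_range_pow_succ (K Δ : ℕ) :
    ∏ j ∈ Finset.range (Δ + 1), K ^ (j + 1) = K * K ^ (Δ * (Δ + 3) / 2) := by
  rw [Finset.prod_pow_eq_pow_sum, ← pow_succ']
  congr 1
  have h1 := Finset.sum_range_id_mul_two (Δ + 2)
  rw [Finset.sum_range_succ'] at h1
  have h2 : (Δ + 2) * (Δ + 2 - 1) = Δ * (Δ + 3) + 2 := by
    simp
    ring
  omega

lemma pow_le_prod_coeffCount {Δ n K M : ℕ} (hn : n ≤ 4 * K * (M - 2)) :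
    n ^ (Δ + 1) ≤ (∏ j ∈ Finset.range (Δ + 1), coeffCount Δ K M j) * K *
      ((4 * (Δ + 1) * (Δ + 2)) ^ (Δ + 1) * K ^ (Δ * (Δ + 3) / 2)) := by
  rcases Nat.eq_zero_or_pos K with rfl | hK
  · simp_all
  calc n ^ (Δ + 1) = ∏ _j ∈ Finset.range (Δ + 1), n := by simp
    _ ≤ ∏ j ∈ Finset.range (Δ + 1),
          (coeffCount Δ K M j * (4 * (Δ + 1) * (Δ + 2)) * K ^ (j + 1)) := by
        refine Finset.prod_le_prod' fun j _ => ?_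
        have h1 : M - 2 < ((Δ + 1) * (Δ + 2) * K ^ j) * coeffCount Δ K M j :=
          Nat.lt_mul_div_succ _ (by positivity)
        calc n ≤ 4 * K * (M - 2) := hn
          _ ≤ 4 * K * (((Δ + 1) * (Δ + 2) * K ^ j) * coeffCount Δ K M j) := by gcongr
          _ = _ := by ring
    _ = _ := by
        rw [Finset.prod_mul_distrib, Finset.prod_mul_distrib, prod_range_pow_succ]
        simp only [Finset.prod_const, Finset.card_range]
        ring

/-- The lower bound up to a constant factor. -/
theorem exists_pow_le_mul_of_slabReportingSolvable {Δ : ℕ} (hΔ : 2 ≤ Δ) (C : ℝ) :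
    ∃ H : ℝ, 1 ≤ H ∧ ∀ (n : ℕ) (q s : ℝ), SlabReportingSolvable Δ n q C s →
      (n : ℝ) ^ (Δ + 1) ≤ H * q ^ (Δ * (Δ + 3) / 2) * s := by
  obtain ⟨c, hc⟩ := exists_nat_ge C
  set L := 2 * (Δ * (1 + 3 * c) + 1) with hL
  set e := Δ * (Δ + 3) / 2 with he
  set Z : ℝ := ((2 ^ (L + 1) * 2 ^ 2 ^ (L + 1) : ℕ) : ℝ)
  set E : ℝ := (((4 * (Δ + 1) * (Δ + 2)) ^ (Δ + 1) : ℕ) : ℝ)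
  set B : ℝ := 2 ^ (L + 3)
  have hB : 1 ≤ B := one_le_pow₀ (by norm_num)
  have h4B : 1 ≤ (4 * B) ^ e := one_le_pow₀ (by linarith)
  have hΔe : Δ + 1 ≤ e := by
    rw [he, Nat.le_div_iff_mul_le two_pos]
    nlinarith
  refine ⟨Z * E * B ^ e + (4 * B) ^ e, le_add_of_nonneg_of_le (by positivity) h4B, ?_⟩
  intro n q s h
  obtain ⟨hq, hs⟩ := h.one_le
  set K := ⌈q⌉₊ * 2 ^ (L + 2) with hK
  have hqceil : 1 ≤ ⌈q⌉₊ := Nat.one_le_ceil_iff.2 (by linarith)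
  have hKL : 2 ^ (L + 2) ≤ K := Nat.le_mul_of_pos_left _ hqceil
  have hqK : q ≤ K := by
    have h1 : ⌈q⌉₊ ≤ K := Nat.le_mul_of_pos_right _ (by positivity)
    exact (Nat.le_ceil q).trans (by exact_mod_cast h1)
  have hKB : (K : ℝ) ≤ B * q := by
    have h1 := Nat.ceil_lt_add_one (by linarith : 0 ≤ q)
    have h2 : (⌈q⌉₊ : ℝ) ≤ 2 * q := by linarith
    calc (K : ℝ) = ⌈q⌉₊ * 2 ^ (L + 2) := by rw [hK]; push_cast; rfl
      _ ≤ 2 * q * 2 ^ (L + 2) := by gcongr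
      _ = B * q := by ring
  have hKpos : 0 < K := lt_of_lt_of_le (by positivity) hKL
  -- If `n < 4 * K`, the grid has fewer than four rows, but then `q` is of order `n`, and the
  -- right-hand side is large enough for the trivial bound `1 ≤ s`.
  rcases le_or_gt (4 * K) n with hKn | hKn
  · have hM : 4 ≤ n / K := (Nat.le_div_iff_mul_le hKpos).2 hKn
    have h1 : K * (n / K) ≤ n := Nat.mul_div_le n K
    have h2 : n < K * (n / K + 1) := Nat.lt_mul_div_succ n hKpos
    have h3 : n ≤ 4 * K * (n / K - 2) :=
      calc n ≤ K * (n / K + 1) := h2.le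
        _ ≤ K * (4 * (n / K - 2)) := by gcongr; omega
        _ = _ := by ring
    have h4 := prod_coeffCount_mul_le (by omega) h1 h2.le hqK hc hL.ge hKL h
    have h5 : (n : ℝ) ^ (Δ + 1) ≤
        (((∏ j ∈ Finset.range (Δ + 1), coeffCount Δ K (n / K) j) * K : ℕ) : ℝ) * (E * K ^ e) := by
      simp only [E]
      exact_mod_cast pow_le_prod_coeffCount (Δ := Δ) h3
    calc (n : ℝ) ^ (Δ + 1) ≤ Z * s * (E * (B * q) ^ e) := h5.trans (by gcongr)
      _ = Z * E * B ^ e * q ^ e * s := by ring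
      _ ≤ _ := by
        gcongr
        exact le_add_of_nonneg_right (by positivity)
  · rcases Nat.eq_zero_or_pos n with rfl | hn
    · rw [Nat.cast_zero, zero_pow (Nat.succ_ne_zero _)]
      positivity
    have hn1 : (1 : ℝ) ≤ n := by exact_mod_cast hn
    have h1 : (n : ℝ) ≤ 4 * B * q := by
      have : (n : ℝ) ≤ 4 * K := by exact_mod_cast hKn.le
      linarith
    calc (n : ℝ) ^ (Δ + 1) ≤ (n : ℝ) ^ e := pow_le_pow_right₀ hn1 hΔe
      _ ≤ (4 * B * q) ^ e := by gcongr
      _ = (4 * B) ^ e * q ^ e * 1 := by ring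
      _ ≤ _ := by
        gcongr
        exact le_add_of_nonneg_left (by positivity)

/-! ### Absorbing constants and logarithms into the exponent -/

lemma rpow_log_div_log {n : ℕ} (hn : 2 ≤ n) {y : ℝ} (hy : 0 < y) :
    (n : ℝ) ^ (Real.log y / Real.log n) = y := by
  have h1 : (1 : ℝ) < n := by exact_mod_cast hn
  exact Real.rpow_logb (by linarith) h1.ne' hy

lemma tendsto_log_max_one_mul_log_rpow_div_log (A b : ℝ) :
    Tendsto (fun n : ℕ => Real.log (max 1 (A * Real.log n ^ b)) / Real.log n) atTop (𝓝 0) := by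
  have hlog : Tendsto (fun n : ℕ => Real.log n) atTop atTop :=
    Real.tendsto_log_atTop.comp tendsto_natCast_atTop_atTop
  suffices h : Tendsto (fun x : ℝ => Real.log (max 1 (A * x ^ b)) / x) atTop (𝓝 0) from h.comp hlog
  have hbound : Tendsto (fun x : ℝ => Real.log (1 + |A|) / x + |b| * (Real.log x / x))
      atTop (𝓝 0) := by
    have h1 : Tendsto (fun x : ℝ => Real.log (1 + |A|) / x) atTop (𝓝 0) :=
      tendsto_const_nhds.div_atTop tendsto_id
    have h2 : Tendsto (fun x : ℝ => Real.log x / x) atTop (𝓝 0) :=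
      Real.isLittleO_log_id_atTop.tendsto_div_nhds_zero
    simpa using h1.add (h2.const_mul |b|)
  refine squeeze_zero' ?_ ?_ hbound
  · filter_upwards [eventually_ge_atTop 1] with x hx
    exact div_nonneg (Real.log_nonneg (le_max_left _ _)) (by linarith)
  · filter_upwards [eventually_ge_atTop 1] with x hx
    have hx0 : 0 < x := by linarith
    have h1 : 1 ≤ x ^ |b| := Real.one_le_rpow hx (abs_nonneg b)
    have h2 : x ^ b ≤ x ^ |b| := Real.rpow_le_rpow_of_exponent_le hx (le_abs_self b)
    have h3 : max 1 (A * x ^ b) ≤ (1 + |A|) * x ^ |b| := by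
      refine max_le ?_ ?_
      · nlinarith [abs_nonneg A]
      · calc A * x ^ b ≤ |A| * x ^ |b| :=
              mul_le_mul (le_abs_self A) h2 (by positivity) (abs_nonneg A)
          _ ≤ _ := by gcongr; linarith
    calc Real.log (max 1 (A * x ^ b)) / x ≤ Real.log ((1 + |A|) * x ^ |b|) / x := by gcongr
      _ = _ := by
        rw [Real.log_mul (by positivity) (by positivity), Real.log_rpow hx0]
        ring

theorem mainTheorem1 (Δ : ℕ) (hΔ : 2 ≤ Δ) (C : ℝ) :
    (∃ ε : ℕ → ℝ, Tendsto ε atTop (𝓝 0) ∧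
      ∀ᶠ n : ℕ in atTop, ∀ q s : ℝ, SlabReportingSolvable Δ n q C s →
        (n : ℝ) ^ ((Δ : ℝ) + 1 - ε n) / q ^ (((Δ : ℝ) + 3) * (Δ : ℝ) / 2) ≤ s) ∧
    (∀ A b : ℝ, ∃ ε : ℕ → ℝ, Tendsto ε atTop (𝓝 0) ∧
      ∀ᶠ n : ℕ in atTop, ∀ q s : ℝ, q ≤ A * Real.log n ^ b →
        SlabReportingSolvable Δ n q C s → (n : ℝ) ^ ((Δ : ℝ) + 1 - ε n) ≤ s) := by
  obtain ⟨H, hH, hmain⟩ := exists_pow_le_mul_of_slabReportingSolvable hΔ C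
  set e := Δ * (Δ + 3) / 2 with he
  have he' : ((Δ : ℝ) + 3) * (Δ : ℝ) / 2 = e := by
    have h1 : 2 ∣ Δ * (Δ + 3) := by
      rcases Nat.even_or_odd' Δ with ⟨k, rfl | rfl⟩
      · exact ⟨k * (2 * k + 3), by ring⟩
      · exact ⟨(2 * k + 1) * (k + 2), by ring⟩
    rw [he, Nat.cast_div h1 (by norm_num)]
    push_cast
    ring
  have hlog : Tendsto (fun n : ℕ => Real.log n) atTop atTop :=
    Real.tendsto_log_atTop.comp tendsto_natCast_atTop_atTop
  have hsplit : ∀ {n : ℕ}, 2 ≤ n → ∀ {y : ℝ}, 0 < y →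
      (n : ℝ) ^ ((Δ : ℝ) + 1 - Real.log y / Real.log n) = (n : ℝ) ^ (Δ + 1) / y := by
    intro n hn y hy
    have hn0 : (0 : ℝ) < n := by exact_mod_cast (by omega : 0 < n)
    rw [Real.rpow_sub hn0, rpow_log_div_log hn hy]
    norm_cast
  constructor
  · refine ⟨fun n => Real.log H / Real.log n, tendsto_const_nhds.div_atTop hlog, ?_⟩
    filter_upwards [eventually_ge_atTop 2] with n hn q s h
    have hq := h.one_le.1
    rw [hsplit hn (by linarith), he', Real.rpow_natCast, div_div, div_le_iff₀ (by positivity),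
      mul_comm s]
    exact hmain n q s h
  · intro A b
    let g : ℕ → ℝ := fun n => max 1 (A * Real.log n ^ b)
    have hg : ∀ n, 1 ≤ g n := fun n => le_max_left _ _
    refine ⟨fun n => Real.log (H * g n ^ e) / Real.log n, ?_, ?_⟩
    · have h1 := (tendsto_const_nhds (x := Real.log H)).div_atTop hlog
      have h2 := (tendsto_log_max_one_mul_log_rpow_div_log A b).const_mul (e : ℝ)
      have h3 := h1.add h2
      rw [mul_zero, add_zero] at h3
      refine h3.congr fun n => ?_
      have hgn : 0 < g n := by linarith [hg n]
      rw [Real.log_mul (by positivity) (by positivity), Real.log_pow]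
      ring
    · filter_upwards [eventually_ge_atTop 2] with n hn q s hqA h
      obtain ⟨hq, hs⟩ := h.one_le
      have hgn : 0 < g n := by linarith [hg n]
      have hqg : q ≤ g n := hqA.trans (le_max_right _ _)
      rw [hsplit hn (by positivity), div_le_iff₀ (by positivity), mul_comm s]
      exact (hmain n q s h).trans (by gcongr)
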